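/- There is a universal constant $C>0$ such that the following holds. Let $n\ge 1$, let $S\subseteq\{1,\dots,n\}$ be a non-empty set of cardinality $s$, let $x\in\mathbb{C}^n$ be a vector supported on $S$ (that is, $x_i=0$ for $i\notin S$), let $\varepsilon\in(0,1)$, and let $m\ge 1$ be an integer. Set $\pi_k=\delta_{k,S}/s$ for $1\le k\le n$, where $\delta_{k,S}=1$ if $k\in S$ and $\delta_{k,S}=0$ otherwise. Let $K_1,\dots,K_m$ be i.i.d. random variables with $\mathbb{P}(K_\ell=k)=\pi_k$ for $1\le k\le n$, and let $$A=\frac1{\sqrt m}\left(\frac1{\sqrt{\pi_{K_\ell}}}\,e_{K_\ell}^*\right)_{1\le \ell\le m}\in\mathbb{C}^{m\times n}$$ be the random sensing matrix made of isolated measurements drawn from the rows $e_1^*,\dots,e_n^*$ of $A_0=\mathrm{Id}_n$. If $$m\ge C\, s\,\ln(s)\,\ln\left(\frac{n}{\varepsilon}\right),$$ then, with probability at least $1-\varepsilon$, $x$ is the unique solution of the problem $$\min_{z\in\mathbb{C}^n,\ Az=Ax}\|z\|_1 .$$ -/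

import Mathlib

open MeasureTheory ProbabilityTheory
open scoped Matrix

noncomputable section

/-- The `ℓ¹` norm of a vector in `ℂⁿ`. -/
def l1Norm {n : ℕ} (z : Fin n → ℂ) : ℝ := ∑ i, ‖z i‖

/-- The set of solutions (minimizers) of the problem: minimize `‖z‖₁` over the `z ∈ ℂⁿ` with
`A z = y`. -/
def l1Minimizers {m n : ℕ} (A : Matrix (Fin m) (Fin n) ℂ) (y : Fin m → ℂ) : Set (Fin n → ℂ) :=
  {z | A *ᵥ z = y ∧ ∀ w : Fin n → ℂ, A *ᵥ w = y → l1Norm z ≤ l1Norm w}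

/-- The sensing matrix of isolated measurements. Its `ℓ`-th row is the row of index `κ ℓ` of `A₀`,
multiplied by `1 / √(π_{κ ℓ})` and by `1 / √m`. -/
def isolatedSensingMatrix {m n : ℕ} (A₀ : Matrix (Fin n) (Fin n) ℂ) (p : Fin n → ℝ)
    (κ : Fin m → Fin n) : Matrix (Fin m) (Fin n) ℂ :=
  Matrix.of fun l j =>
    ((1 / Real.sqrt (m : ℝ) : ℝ) : ℂ) * (((1 / Real.sqrt (p (κ l)) : ℝ) : ℂ) * A₀ (κ l) j)

/-- The drawing distribution `π_k = δ_{k,S} / s`, where `s` is the cardinality of `S`. -/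
def supportDrawing {n : ℕ} (S : Finset (Fin n)) (k : Fin n) : ℝ :=
  (if k ∈ S then 1 else 0) / (S.card : ℝ)

end

/-! A row drawn at `k ∈ S` is a non-zero multiple of `e_k^*`. Once every index of `S` is drawn, `Az
= Ax` forces `z = x` on `S`, and any mass off `S` only increases the norm. Failure thus requires a
missed coupon, with probability at most `s(1 - 1/s)^m ≤ n exp(-m/s)`, which is at most `ε` as soon
as `m ≥ s ln(n/ε)`. -/

/-- If every index of the support of `x` is measured, `x` is the unique `ℓ¹` minimizer. -/
theorem l1Minimizers_isolatedSensingMatrix_eq_singleton {n m : ℕ} (S : Finset (Fin n))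
    (x : Fin n → ℂ) (hx : ∀ i, i ∉ S → x i = 0) (κ : Fin m → Fin n)
    (hκ : ∀ k ∈ S, ∃ l, κ l = k) :
    l1Minimizers (isolatedSensingMatrix 1 (supportDrawing S) κ)
      (isolatedSensingMatrix 1 (supportDrawing S) κ *ᵥ x) = {x} := by
  have hrow : ∀ (z : Fin n → ℂ) (l : Fin m),
      (isolatedSensingMatrix 1 (supportDrawing S) κ *ᵥ z) l =
        ((1 / Real.sqrt (m : ℝ) : ℝ) : ℂ) *
          (((1 / Real.sqrt (supportDrawing S (κ l)) : ℝ) : ℂ)) * z (κ l) := by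
    intro z l
    simp [Matrix.mulVec, dotProduct, isolatedSensingMatrix, Matrix.one_apply]
  have hagree : ∀ z : Fin n → ℂ, isolatedSensingMatrix 1 (supportDrawing S) κ *ᵥ z =
      isolatedSensingMatrix 1 (supportDrawing S) κ *ᵥ x → ∀ k ∈ S, z k = x k := by
    intro z hz k hk
    obtain ⟨l, rfl⟩ := hκ k hk
    have h := congrFun hz l
    rw [hrow, hrow] at h
    refine mul_left_cancel₀ (mul_ne_zero ?_ ?_) h
    · have hm : (0 : ℝ) < m := by exact_mod_cast l.pos
      exact_mod_cast (one_div_pos.2 (Real.sqrt_pos.2 hm)).ne'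
    -- Membership in `S` matters: elsewhere the weight `1 / √0` is `0` and the row vanishes.
    · have hp : 0 < supportDrawing S (κ l) := by
        simpa [supportDrawing, hk] using Finset.card_pos.2 ⟨_, hk⟩
      exact_mod_cast (one_div_pos.2 (Real.sqrt_pos.2 hp)).ne'
  have hle : ∀ z : Fin n → ℂ, (∀ k ∈ S, z k = x k) → ∀ i, ‖x i‖ ≤ ‖z i‖ := by
    intro z hz i
    by_cases hi : i ∈ S
    · rw [hz i hi]
    · simp [hx i hi]
  ext z
  simp only [l1Minimizers, Set.mem_ofPred_eq, Set.mem_singleton_iff]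
  constructor
  · rintro ⟨hz, hmin⟩
    have hS := hagree z hz
    have hsum : ∑ i, ‖x i‖ = ∑ i, ‖z i‖ :=
      le_antisymm (Finset.sum_le_sum fun i _ => hle z hS i) (hmin x rfl)
    have heq := (Finset.sum_eq_sum_iff_of_le fun i _ => hle z hS i).1 hsum
    funext i
    by_cases hi : i ∈ S
    · exact hS i hi
    · have h := heq i (Finset.mem_univ i)
      rw [hx i hi, norm_zero] at h
      rw [hx i hi, norm_eq_zero.1 h.symm]
  · rintro rfl
    exact ⟨rfl, fun w hw => Finset.sum_le_sum fun i _ => hle w (hagree w hw) i⟩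

/-- The probability that `m` independent uniform draws from `S` miss a given element of `S`. -/
theorem measureReal_forall_ne_eq_pow {n m : ℕ} {S : Finset (Fin n)} {Ω : Type*}
    [MeasurableSpace Ω] {P : Measure Ω} [IsProbabilityMeasure P] {K : Fin m → Ω → Fin n}
    (hK : ∀ l, Measurable (K l)) (hind : iIndepFun K P)
    (hlaw : ∀ l k, P.real {ω | K l ω = k} = supportDrawing S k) {k : Fin n} (hk : k ∈ S) :
    P.real {ω | ∀ l, K l ω ≠ k} = (1 - 1 / (S.card : ℝ)) ^ m := by
  have h := hind.measure_inter_preimage_eq_mul Finset.univ (sets := fun _ => {k}ᶜ)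
    (fun _ _ => (measurableSet_singleton k).compl)
  have hset : {ω | ∀ l, K l ω ≠ k} = ⋂ l ∈ Finset.univ, K l ⁻¹' {k}ᶜ := by
    ext ω
    simp
  rw [hset, Measure.real, h, ENNReal.toReal_prod]
  have hone : ∀ l, (P (K l ⁻¹' {k}ᶜ)).toReal = 1 - 1 / (S.card : ℝ) := by
    intro l
    have hc := probReal_compl_eq_one_sub (μ := P) (hK l (measurableSet_singleton k))
    have hl : P.real (K l ⁻¹' {k}) = 1 / (S.card : ℝ) := by
      exact (hlaw l k).trans (by simp [supportDrawing, hk])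
    rw [hl] at hc
    exact hc
  rw [Finset.prod_congr rfl fun l _ => hone l]
  simp

/-- Coupon collector bound: the probability that `m` independent uniform draws miss some element
of `S`. -/
theorem measureReal_exists_forall_ne_le {n m : ℕ} {S : Finset (Fin n)} {Ω : Type*}
    [MeasurableSpace Ω] {P : Measure Ω} [IsProbabilityMeasure P] {K : Fin m → Ω → Fin n}
    (hK : ∀ l, Measurable (K l)) (hind : iIndepFun K P)
    (hlaw : ∀ l k, P.real {ω | K l ω = k} = supportDrawing S k) :
    P.real {ω | ∃ k ∈ S, ∀ l, K l ω ≠ k} ≤ S.card * (1 - 1 / (S.card : ℝ)) ^ m := by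
  have hset : {ω | ∃ k ∈ S, ∀ l, K l ω ≠ k} = ⋃ k ∈ S, {ω | ∀ l, K l ω ≠ k} := by
    ext ω
    simp
  rw [hset]
  refine (measureReal_biUnion_finset_le S _).trans ?_
  rw [Finset.sum_congr rfl fun k hk => measureReal_forall_ne_eq_pow hK hind hlaw hk]
  simp

/-- The constant 2 comes from `2 ln 2 > 1`: for `s ≥ 2` the factor `2 ln s` can be dropped. For `s =
1` the hypothesis `h` is void, but `0 ^ m = 0` since `m > 0`. -/
theorem card_mul_one_sub_inv_pow_le {s n m : ℕ} {ε : ℝ} (hs : 0 < s) (hsn : s ≤ n)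
    (hε : 0 < ε) (hε1 : ε < 1) (hm : 0 < m)
    (h : 2 * (s : ℝ) * Real.log s * Real.log ((n : ℝ) / ε) ≤ m) :
    (s : ℝ) * (1 - 1 / (s : ℝ)) ^ m ≤ ε := by
  rcases Nat.lt_or_ge s 2 with h2 | h2
  · obtain rfl : s = 1 := by omega
    simp [hm.ne', hε.le]
  have hs0 : (0 : ℝ) < s := by exact_mod_cast hs
  have hn0 : (0 : ℝ) < n := by exact_mod_cast hs.trans_le hsn
  have hn1 : (1 : ℝ) ≤ n := by exact_mod_cast hs.trans_le hsn
  have hlogs : 1 ≤ 2 * Real.log s := by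
    have : Real.log 2 ≤ Real.log s := Real.log_le_log (by norm_num) (by exact_mod_cast h2)
    linarith [Real.log_two_gt_d9]
  have hlogn : 0 ≤ Real.log ((n : ℝ) / ε) :=
    Real.log_nonneg ((one_le_div hε).2 (hε1.le.trans hn1))
  have hlog : Real.log ((n : ℝ) / ε) ≤ m / s := by
    rw [le_div_iff₀ hs0]
    nlinarith [mul_le_mul_of_nonneg_right hlogs (mul_nonneg hs0.le hlogn)]
  have hbase : (1 - 1 / (s : ℝ)) ^ m ≤ Real.exp (-(m / s)) := by
    have h0 : 0 ≤ 1 - 1 / (s : ℝ) := by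
      rw [sub_nonneg, div_le_one hs0]
      exact_mod_cast hs
    calc (1 - 1 / (s : ℝ)) ^ m ≤ Real.exp (-(1 / s)) ^ m :=
          pow_le_pow_left₀ h0 (Real.one_sub_le_exp_neg _) m
      _ = Real.exp (-(m / s)) := by
          rw [← Real.exp_nat_mul]
          congr 1
          ring
  calc (s : ℝ) * (1 - 1 / (s : ℝ)) ^ m
      ≤ n * Real.exp (-Real.log ((n : ℝ) / ε)) := by
        refine mul_le_mul (by exact_mod_cast hsn)
          (hbase.trans (Real.exp_le_exp.2 (neg_le_neg hlog))) ?_ hn0.le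
        refine pow_nonneg ?_ m
        rw [sub_nonneg, div_le_one hs0]
        exact_mod_cast hs
    _ = ε := by
        rw [Real.exp_neg, Real.exp_log (div_pos hn0 hε)]
        field_simp

theorem mainTheorem7 :
    ∃ C : ℝ, 0 < C ∧
      ∀ (n m : ℕ) (S : Finset (Fin n)) (x : Fin n → ℂ) (ε : ℝ),
        S.Nonempty → (∀ i, i ∉ S → x i = 0) → 0 < ε → ε < 1 → 0 < m →
        C * (S.card : ℝ) * Real.log (S.card : ℝ) * Real.log ((n : ℝ) / ε) ≤ (m : ℝ) →
        ∀ (Ω : Type*) [MeasurableSpace Ω] (P : Measure Ω) [IsProbabilityMeasure P]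
          (K : Fin m → Ω → Fin n),
          (∀ l, Measurable (K l)) → iIndepFun K P →
          (∀ l k, P.real {ω | K l ω = k} = supportDrawing S k) →
          1 - ε ≤ P.real {ω |
            l1Minimizers (isolatedSensingMatrix 1 (supportDrawing S) (fun l => K l ω))
              (isolatedSensingMatrix 1 (supportDrawing S) (fun l => K l ω) *ᵥ x) = {x}} := by
  refine ⟨2, two_pos, ?_⟩
  intro n m S x ε hS hx hε hε1 hm hle Ω _ P _ K hK hind hlaw
  have hbad : P.real {ω | ∃ k ∈ S, ∀ l, K l ω ≠ k} ≤ ε :=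
    (measureReal_exists_forall_ne_le hK hind hlaw).trans
      (card_mul_one_sub_inv_pow_le (Finset.card_pos.2 hS)
        ((Finset.card_le_univ S).trans_eq (Fintype.card_fin n)) hε hε1 hm hle)
  set E : Set Ω := {ω |
    l1Minimizers (isolatedSensingMatrix 1 (supportDrawing S) (fun l => K l ω))
      (isolatedSensingMatrix 1 (supportDrawing S) (fun l => K l ω) *ᵥ x) = {x}} with hE
  -- Covering `Ω` and using subadditivity avoids proving `E` measurable.
  have hcover : (Set.univ : Set Ω) ⊆ E ∪ {ω | ∃ k ∈ S, ∀ l, K l ω ≠ k} := by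
    intro ω _
    by_cases hω : ∃ k ∈ S, ∀ l, K l ω ≠ k
    · exact Or.inr hω
    · push Not at hω
      exact Or.inl (l1Minimizers_isolatedSensingMatrix_eq_singleton S x hx _ hω)
  have h1 : 1 ≤ P.real E + P.real {ω | ∃ k ∈ S, ∀ l, K l ω ≠ k} :=
    calc (1 : ℝ) = P.real Set.univ := probReal_univ.symm
      _ ≤ _ := measureReal_mono hcover
      _ ≤ _ := measureReal_union_le _ _
  linarith
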